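/- For a finite subset $K$ of a group $G$ and a group $C$, a map $\varphi\colon G\to C$ is a $K$-almost-homomorphism if $\varphi(k_1k_2)=\varphi(k_1)\varphi(k_2)$ for all $k_1,k_2\in K$ and $\varphi|_K$ is injective. If $\mathcal{C}$ is a class of groups, a group $G$ is locally embeddable into $\mathcal{C}$ (an LE-$\mathcal{C}$ group) if for every finite subset $K\subseteq G$ there exist a group $C\in\mathcal{C}$ and a $K$-almost-homomorphism $G\to C$. Let $\mathcal{C}$ be one of the following classes of groups: (1) finite groups; (2) finite $p$-groups, for a fixed prime $p$; (3) solvable groups; (4) free groups; (5) elementary amenable groups, that is, the smallest class of groups that contains the finite and the solvable groups and is closed under subgroups, quotients, extensions and direct limits; (6) (discrete) amenable groups. Then the class of LE-$\mathcal{C}$ groups is closed under free products of arbitrary families: if $(G_i)_{i\in I}$ is a family of LE-$\mathcal{C}$ groups, then $\ast_{i\in I}G_i$ is an LE-$\mathcal{C}$ group. In particular (case (6)), the class of LEA groups (groups locally embeddable into amenable groups) is closed under free products. -/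

import Mathlib

universe u

/-- `φ : G → C` is a `K`-almost-homomorphism: it is multiplicative on products of two elements
of `K`, and injective on `K`. -/
def IsAlmostHom {G C : Type u} [Group G] [Group C] (K : Finset G) (φ : G → C) : Prop :=
  (∀ k₁ ∈ K, ∀ k₂ ∈ K, φ (k₁ * k₂) = φ k₁ * φ k₂) ∧ Set.InjOn φ (K : Set G)

/-- `G` is locally embeddable into the class `P` of groups (`G` is an LE-`P` group): every finite
subset `K` of `G` admits a `K`-almost-homomorphism into a group of the class. -/
def IsLocallyEmbeddable (P : (C : Type u) → [Group C] → Prop) (G : Type u) [Group G] : Prop :=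
  ∀ K : Finset G, ∃ (C : Type u) (_ : Group C), P C ∧ ∃ φ : G → C, IsAlmostHom K φ

/-- The class `P` of groups is closed under free products (of arbitrary families). -/
def ClosedUnderFreeProducts (P : (G : Type u) → [Group G] → Prop) : Prop :=
  ∀ (ι : Type u) (G : ι → Type u) [∀ i, Group (G i)],
    (∀ i, P (G i)) → P (Monoid.CoprodI G)

/-- A real function is bounded. -/
def IsBoundedFun {X : Type u} (f : X → ℝ) : Prop := ∃ B : ℝ, ∀ x, |f x| ≤ B

/-- `m` restricts to a left-invariant mean on the space of bounded real functions on `G`: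
a positive, normalized, left-invariant linear functional. (Values of `m` at unbounded functions
are irrelevant.) -/
structure IsInvariantMean {G : Type u} [Group G] (m : (G → ℝ) → ℝ) : Prop where
  map_add : ∀ f g : G → ℝ, IsBoundedFun f → IsBoundedFun g → m (f + g) = m f + m g
  map_smul : ∀ (c : ℝ) (f : G → ℝ), IsBoundedFun f → m (c • f) = c * m f
  nonneg : ∀ f : G → ℝ, IsBoundedFun f → (∀ x, 0 ≤ f x) → 0 ≤ m f
  map_one : m (fun _ => 1) = 1
  map_left_translate : ∀ (g : G) (f : G → ℝ), IsBoundedFun f → m (fun x => f (g * x)) = m f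

/-- A (discrete) group is amenable if the bounded real functions on it have a left-invariant
mean. -/
def IsAmenable (G : Type u) [Group G] : Prop := ∃ m : (G → ℝ) → ℝ, IsInvariantMean m

/-- The class of elementary amenable groups: the smallest class of groups that contains the finite
and the solvable groups and is closed under subgroups, quotients, extensions and direct limits
(in particular under isomorphism). -/
inductive IsElementaryAmenable : (G : Type u) → [Group G] → Prop
  | of_finite (G : Type u) [Group G] (h : Finite G) : IsElementaryAmenable G
  | of_solvable (G : Type u) [Group G] (h : Group.IsSolvable G) : IsElementaryAmenable G
  | of_injective {G H : Type u} [Group G] [Group H] (f : H →* G) (hf : Function.Injective f)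
      (hG : IsElementaryAmenable G) : IsElementaryAmenable H
  | of_surjective {G Q : Type u} [Group G] [Group Q] (f : G →* Q) (hf : Function.Surjective f)
      (hG : IsElementaryAmenable G) : IsElementaryAmenable Q
  | of_extension {G : Type u} [Group G] (N : Subgroup G) [N.Normal]
      (hN : IsElementaryAmenable N) (hQ : IsElementaryAmenable (G ⧸ N)) : IsElementaryAmenable G
  | of_directLimit {ι : Type u} [Preorder ι] [IsDirectedOrder ι] [Nonempty ι]
      (G : ι → Type u) [∀ i, Group (G i)] (f : ∀ i j, i ≤ j → G i →* G j)
      [DirectedSystem G (fun i j h => f i j h)]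
      (hG : ∀ i, IsElementaryAmenable (G i)) : IsElementaryAmenable (DirectLimit G f)

/-! Fix a finite set `K` in the free product. Only finitely many factors and syllables matter, so
almost-homomorphisms `φ i : G i → C i` that are exact on large enough finite sets extend syllable by
syllable to a map that is multiplicative on `K` (`exists_finset_mapProd_mul`). It remains to find a
group in the class with homomorphisms from the `C i` under which no reduced word of length at most
`N` in the factors concerned dies. For free groups, the free product of the `C i` will do.

For the other classes, let `Q` be the finite product of the relevant `C j`, `L` a finite set of
labels and `A` a finite `p`-group. In `A^(A^(Q × L)) ⋊ Q` take for each label `ℓ` the conjugate of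
`Q` by evaluation at `(1, ℓ)`. The first component of a product of such conjugates is a group word
in the values `f (q, ℓ)`. Nontrivial syllables and distinct adjacent labels make its consecutive
letters distinct (`isChain_conjLetters`). A unitriangular group `A` of large size over `ZMod p` does
not have this word as a law (`exists_prod_unitriangular_ne_one`), so the product is nontrivial.

The class thus only has to contain the trivial group and the powers of `A` used, and be closed under
extensions (`IsFreeProductStable`). -/

/-! ### Syllablewise maps on reduced words -/

section Words

open scoped Pointwise

namespace Monoid.CoprodI.Word

variable {ι : Type*} {G : ι → Type*} [∀ i, Group (G i)] {T : Type*} [Group T]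

/-- The product of the images of the syllables of a reduced word under a family of maps. -/
def mapProd (ψ : ∀ i, G i → T) (w : Word G) : T :=
  (w.toList.map fun l => ψ l.1 l.2).prod

theorem mapProd_rcons [∀ i, DecidableEq (G i)] {ψ : ∀ i, G i → T} (hψ : ∀ i, ψ i 1 = 1) {i : ι}
    (p : Pair G i) : (rcons p).mapProd ψ = ψ i p.head * p.tail.mapProd ψ := by
  by_cases h : p.head = 1
  · simp [rcons, h, hψ]
  · simp [rcons, h, mapProd]

variable [DecidableEq ι] [∀ i, DecidableEq (G i)]

theorem rcons_equivPair (i : ι) (w : Word G) : rcons (equivPair i w) = w :=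
  (equivPair i).symm_apply_apply w

theorem equivPair_head_mem {i : ι} {w : Word G} {U : Set (G i)} (h1 : 1 ∈ U)
    (hw : ∀ h : G i, (⟨i, h⟩ : Σ i, G i) ∈ w.toList → h ∈ U) : (equivPair i w).head ∈ U := by
  by_cases h : (equivPair i w).head = 1
  · rwa [h]
  · refine hw _ ?_
    have := (mem_rcons_iff (equivPair i w) (equivPair i w).head).2 (Or.inr ⟨h, rfl, rfl⟩)
    rwa [rcons_equivPair] at this

/-- Left multiplication by `of g` alters only the leading syllable in factor `i`, with head `1` if
there is none; so multiplicativity of `ψ i` at `g` and that head is enough. -/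
theorem mapProd_of_smul {ψ : ∀ i, G i → T} (hψ : ∀ i, ψ i 1 = 1) {i : ι} {g : G i} {U : Set (G i)}
    (h1 : 1 ∈ U) (hg : ∀ h ∈ U, ψ i (g * h) = ψ i g * ψ i h) {w : Word G}
    (hw : ∀ h : G i, (⟨i, h⟩ : Σ i, G i) ∈ w.toList → h ∈ U) :
    (of g • w).mapProd ψ = ψ i g * w.mapProd ψ := by
  conv_rhs => rw [← rcons_equivPair i w]
  rw [of_smul_def, mapProd_rcons hψ, mapProd_rcons hψ, hg _ (equivPair_head_mem h1 hw), mul_assoc]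

theorem mem_of_smul {i : ι} {g : G i} {U V : ∀ i, Set (G i)} (h1 : 1 ∈ U i)
    (hUV : ∀ j, U j ⊆ V j) (hg : ∀ h ∈ U i, g * h ∈ V i) {w : Word G}
    (hw : ∀ l ∈ w.toList, l.2 ∈ U l.1) : ∀ l ∈ (of g • w).toList, l.2 ∈ V l.1 := by
  rintro ⟨j, m⟩ hl
  rw [of_smul_def, mem_rcons_iff] at hl
  rcases hl with hl | ⟨-, rfl, rfl⟩
  · exact hUV _ (hw _ (mem_of_mem_equivPair_tail _ hl))
  · exact hg _ (equivPair_head_mem h1 fun h hh => hw _ hh)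

/-- If the maps `ψ i` are multiplicative on the sets `S i ^ N`, then `mapProd ψ` is compatible with
left multiplication by products of few syllables from the sets `S i`. -/
theorem mapProd_list_smul {ψ : ∀ i, G i → T} (hψ : ∀ i, ψ i 1 = 1) {S : ∀ i, Set (G i)}
    (h1 : ∀ i, 1 ∈ S i) {N : ℕ}
    (hS : ∀ i, ∀ g ∈ S i ^ N, ∀ h ∈ S i ^ N, ψ i (g * h) = ψ i g * ψ i h) {m : ℕ} {w : Word G}
    (hw : ∀ l ∈ w.toList, l.2 ∈ S l.1 ^ m) (L : List (Σ i, G i)) (hL : ∀ l ∈ L, l.2 ∈ S l.1)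
    (hN : m + L.length ≤ N) :
    (((L.map fun l => of l.2).prod : CoprodI G) • w).mapProd ψ =
        (L.map fun l => ψ l.1 l.2).prod * w.mapProd ψ ∧
      ∀ l ∈ (((L.map fun l => of l.2).prod : CoprodI G) • w).toList,
        l.2 ∈ S l.1 ^ (m + L.length) := by
  induction L with
  | nil => simpa using hw
  | cons a L ih =>
    simp only [List.length_cons] at hN
    obtain ⟨ih1, ih2⟩ := ih (fun l hl => hL l (List.mem_cons_of_mem _ hl)) (by omega)
    have ha := hL a List.mem_cons_self
    have hone : ∀ (i : ι) (k : ℕ), (1 : G i) ∈ S i ^ k := fun i k => Set.one_mem_pow (h1 i)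
    simp only [List.map_cons, List.prod_cons, mul_smul, List.length_cons]
    constructor
    · rw [mapProd_of_smul hψ (hone a.1 (m + L.length)), ih1, mul_assoc]
      · intro h hh
        refine hS _ _ ?_ _ (Set.pow_subset_pow_right (h1 _) (by omega) hh)
        have : S a.1 ^ 1 ⊆ S a.1 ^ N := Set.pow_subset_pow_right (h1 _) (by omega)
        exact this (by simpa using ha)
      · exact fun h hh => ih2 _ hh
    · refine mem_of_smul (U := fun i => S i ^ (m + L.length))
        (V := fun i => S i ^ (m + (L.length + 1))) (hone _ _)
        (fun j => Set.pow_subset_pow_right (h1 j) (by omega)) (fun h hh => ?_) ih2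
      rw [← add_assoc, pow_succ']
      exact Set.mul_mem_mul ha hh

theorem equiv_mul (x y : CoprodI G) : equiv (x * y) = x • equiv y :=
  mul_smul (α := CoprodI G) x y (empty : Word G)

theorem prod_equiv (x : CoprodI G) : (equiv x).prod = x := equiv.symm_apply_apply x

end Monoid.CoprodI.Word

open Monoid.CoprodI Monoid.CoprodI.Word in
/-- The syllables of finitely many elements of a free product lie in finitely many factors, and
multiplicativity of a family of maps on finite subsets of the factors suffices for
multiplicativity of the syllablewise extension on the given elements. -/
theorem Monoid.CoprodI.exists_finset_mapProd_mul {ι : Type*} {G : ι → Type*} [∀ i, Group (G i)]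
    [DecidableEq ι] [∀ i, DecidableEq (G i)] (K : Finset (Monoid.CoprodI G)) :
    ∃ (S : ∀ i, Finset (G i)) (J : Finset ι) (N : ℕ), (∀ i, 1 ∈ S i) ∧
      (∀ x ∈ K, (equiv x).toList.length ≤ N ∧
        ∀ l ∈ (equiv x).toList, l.1 ∈ J ∧ l.2 ∈ S l.1) ∧
      ∀ {T : Type u} [Group T] (ψ : ∀ i, G i → T), (∀ i, ψ i 1 = 1) →
        (∀ i, ∀ g ∈ S i, ∀ h ∈ S i, ψ i (g * h) = ψ i g * ψ i h) →
        ∀ x ∈ K, ∀ y ∈ K,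
          (equiv (x * y)).mapProd ψ = (equiv x).mapProd ψ * (equiv y).mapProd ψ := by
  classical
  let A : Finset (Σ i, G i) := K.biUnion fun x => (equiv x).toList.toFinset
  have hA : ∀ x ∈ K, ∀ l ∈ (equiv x).toList, l ∈ A := fun x hx l hl =>
    Finset.mem_biUnion.2 ⟨x, hx, List.mem_toFinset.2 hl⟩
  let S₀ : ∀ i, Finset (G i) := fun i =>
    insert 1 (A.preimage (Sigma.mk i) sigma_mk_injective.injOn)
  have hS₀ : ∀ l ∈ A, l.2 ∈ S₀ l.1 := fun l hl => by simp [S₀, hl]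
  have h1 : ∀ i, 1 ∈ S₀ i := fun i => Finset.mem_insert_self _ _
  let N := K.sup fun x => (equiv x).toList.length
  have hN : ∀ x ∈ K, (equiv x).toList.length ≤ N := fun x hx =>
    Finset.le_sup (f := fun x => (equiv x).toList.length) hx
  have hsub : ∀ i, S₀ i ⊆ S₀ i ^ (N + 1) := fun i => by
    simpa using Finset.pow_subset_pow_right (h1 i) (Nat.le_add_left 1 N)
  -- Syllables of `y` lie in `S₀ i ^ 1`, and each of the at most `N` syllables of `x` raises the
  -- exponent by at most one.
  refine ⟨fun i => S₀ i ^ (N + 1), A.image Sigma.fst, N, fun i => hsub i (h1 i),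
    fun x hx => ⟨hN x hx, fun l hl => ⟨Finset.mem_image_of_mem _ (hA x hx l hl),
      hsub _ (hS₀ l (hA x hx l hl))⟩⟩, fun {T} _ ψ hψ hmul x hx y hy => ?_⟩
  have := (mapProd_list_smul hψ (S := fun i => (S₀ i : Set (G i))) (N := N + 1) (m := 1)
    (fun i => by exact_mod_cast h1 i)
    (fun i g hg h hh => hmul i g (by exact_mod_cast hg) h (by exact_mod_cast hh))
    (w := equiv y) (fun l hl => by simpa using hS₀ l (hA y hy l hl)) (equiv x).toList
    (fun l hl => by simpa using hS₀ l (hA x hx l hl)) (by have := hN x hx; omega)).1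
  rw [equiv_mul]
  conv_lhs => rw [← prod_equiv x]
  exact this

/-- Local embeddability only requires that nontrivial elements have nontrivial images. -/
theorem isLocallyEmbeddable_of_forall_ne_one {P : (C : Type u) → [Group C] → Prop} {G : Type u}
    [Group G] (h : ∀ K : Finset G, ∃ (C : Type u) (_ : Group C), P C ∧ ∃ φ : G → C,
      (∀ k₁ ∈ K, ∀ k₂ ∈ K, φ (k₁ * k₂) = φ k₁ * φ k₂) ∧ ∀ k ∈ K, k ≠ 1 → φ k ≠ 1) :
    IsLocallyEmbeddable P G := by
  classical
  intro K
  -- Injectivity is tested on the quotients `k₁⁻¹ * k₂`, so these are added to `K`.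
  obtain ⟨C, _, hC, φ, hmul, hne⟩ := h (K ∪ K⁻¹ * K)
  refine ⟨C, _, hC, φ, fun k₁ h₁ k₂ h₂ =>
    hmul _ (Finset.mem_union_left _ h₁) _ (Finset.mem_union_left _ h₂), ?_⟩
  intro k₁ h₁ k₂ h₂ heq
  have hmem : k₁⁻¹ * k₂ ∈ K ∪ K⁻¹ * K :=
    Finset.mem_union_right _ (Finset.mul_mem_mul (Finset.inv_mem_inv h₁) h₂)
  have := hmul k₁ (Finset.mem_union_left _ h₁) _ hmem
  rw [mul_inv_cancel_left, ← heq, left_eq_mul] at this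
  by_contra hk
  exact hne _ hmem (fun h => hk (inv_mul_eq_one.1 h)) this

end Words

/-! ### Unitriangular groups over `ZMod p` -/

/-- The submonoid of upper unitriangular matrices over `ZMod p`. -/
def unitriangularSubmonoid (p n : ℕ) : Submonoid (Matrix (Fin n) (Fin n) (ZMod p))ˣ where
  carrier := {u | ∀ i j : Fin n, j ≤ i → ((u : Matrix (Fin n) (Fin n) (ZMod p)) - 1) i j = 0}
  one_mem' := by simp
  mul_mem' := by
    intro a b ha hb i j hij
    have : ((a * b : (Matrix (Fin n) (Fin n) (ZMod p))ˣ) : Matrix (Fin n) (Fin n) (ZMod p)) - 1 =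
        (a.val - 1) + (b.val - 1) + (a.val - 1) * (b.val - 1) := by
      push_cast; noncomm_ring
    rw [this, Matrix.add_apply, Matrix.add_apply, ha i j hij, hb i j hij, Matrix.mul_apply,
      Finset.sum_eq_zero, add_zero, add_zero]
    intro k _
    rcases le_total k i with h | h
    · rw [ha i k h, zero_mul]
    · rw [hb k j (hij.trans h), mul_zero]

theorem Matrix.pow_apply_eq_zero_of_strictUpper {n : ℕ} {R : Type*} [Semiring R]
    {M : Matrix (Fin n) (Fin n) R} (hM : ∀ i j, j ≤ i → M i j = 0) (k : ℕ) (i j : Fin n)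
    (hij : (j : ℕ) < i + k) : (M ^ k) i j = 0 := by
  induction k generalizing j with
  | zero => rw [pow_zero, Matrix.one_apply_ne]; rintro rfl; omega
  | succ k ih =>
    rw [pow_succ, Matrix.mul_apply]
    refine Finset.sum_eq_zero fun l _ => ?_
    by_cases h : (l : ℕ) < i + k
    · rw [ih l h, zero_mul]
    · rw [hM l j (by rw [Fin.le_def]; omega), mul_zero]

/-- Write `u = 1 + M` with `M` nilpotent; in characteristic `p`, `(1 + M) ^ p ^ k = 1 + M ^ p ^ k`.
This yields both inverses and the `p`-group property. -/
theorem pow_eq_one_of_mem_unitriangularSubmonoid {p : ℕ} [Fact p.Prime] {n : ℕ}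
    {u : (Matrix (Fin (n + 1)) (Fin (n + 1)) (ZMod p))ˣ}
    (hu : u ∈ unitriangularSubmonoid p (n + 1)) : u ^ p ^ (n + 1) = 1 := by
  ext1
  have h0 : (u.val - 1) ^ p ^ (n + 1) = 0 := by
    ext i j
    refine Matrix.pow_apply_eq_zero_of_strictUpper hu _ i j ?_
    have := (Nat.lt_pow_self (n := n + 1) (Fact.out : p.Prime).one_lt)
    omega
  have h := add_pow_char_pow_of_commute p (n := n + 1) (Commute.one_left (u.val - 1))
  rw [h0, add_sub_cancel, one_pow, add_zero] at h
  simpa using h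

/-- The group of upper unitriangular matrices over `ZMod p`. -/
def unitriangular (p : ℕ) [Fact p.Prime] (n : ℕ) :
    Subgroup (Matrix (Fin (n + 1)) (Fin (n + 1)) (ZMod p))ˣ where
  __ := unitriangularSubmonoid p (n + 1)
  inv_mem' := by
    intro u hu
    have h := pow_eq_one_of_mem_unitriangularSubmonoid hu
    have hpos : 0 < p ^ (n + 1) := pow_pos (Fact.out : p.Prime).pos _
    have : u⁻¹ = u ^ (p ^ (n + 1) - 1) := by
      rw [inv_eq_iff_mul_eq_one, ← pow_succ', Nat.sub_add_cancel hpos, h]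
    rw [this]
    exact (unitriangularSubmonoid p (n + 1)).pow_mem hu _

theorem isPGroup_unitriangular (p : ℕ) [Fact p.Prime] (n : ℕ) : IsPGroup p (unitriangular p n) :=
  (isPGroup_iff_pow_pow_eq_one).2 fun g =>
    ⟨n + 1, Subtype.ext (pow_eq_one_of_mem_unitriangularSubmonoid g.2)⟩

/-! ### Words that are not laws of unitriangular groups -/

section superdiagonal

variable {X : Type*} (R : Type*) [Ring R] (n : ℕ) (l : List X)

open Classical in
/-- The matrix with entries `1` at those places `(i, i + 1)` for which `x` is the `i`-th entry of
the list `l`. -/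
noncomputable def superdiagonal (x : X) : Matrix (Fin (n + 1)) (Fin (n + 1)) R :=
  Matrix.of fun i j => if (j : ℕ) = i + 1 ∧ l[(i : ℕ)]? = some x then 1 else 0

variable {l} in
-- A nonzero entry of the square would need the letter `x` at two adjacent places of `l`.
theorem superdiagonal_mul_self (hl : l.IsChain (· ≠ ·)) (x : X) :
    superdiagonal R n l x * superdiagonal R n l x = 0 := by
  ext i j
  rw [Matrix.mul_apply]
  refine Finset.sum_eq_zero fun k _ => ?_
  simp only [superdiagonal, Matrix.of_apply]
  by_cases h₁ : (k : ℕ) = i + 1 ∧ l[(i : ℕ)]? = some x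
  · by_cases h₂ : (j : ℕ) = k + 1 ∧ l[(k : ℕ)]? = some x
    · exfalso
      obtain ⟨hk, hi⟩ := h₁
      obtain ⟨-, hk'⟩ := h₂
      rw [hk] at hk'
      obtain ⟨hi₁, hi₂⟩ := List.getElem?_eq_some_iff.1 hi
      obtain ⟨hk₁, hk₂⟩ := List.getElem?_eq_some_iff.1 hk'
      exact List.isChain_iff_getElem.1 hl i hk₁ (hi₂.trans hk₂.symm)
    · rw [if_neg h₂, mul_zero]
  · rw [if_neg h₁, zero_mul]

variable {l} in
/-- The unit `1 + superdiagonal R n l x`. -/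
noncomputable def superdiagonalUnit (hl : l.IsChain (· ≠ ·)) (x : X) :
    (Matrix (Fin (n + 1)) (Fin (n + 1)) R)ˣ where
  val := 1 + superdiagonal R n l x
  inv := 1 - superdiagonal R n l x
  val_inv := by
    rw [(Commute.one_left _).mul_self_sub_mul_self_eq.symm, superdiagonal_mul_self R n hl]; simp
  inv_val := by
    rw [(Commute.one_left _).mul_self_sub_mul_self_eq'.symm, superdiagonal_mul_self R n hl]; simp

end superdiagonal

theorem superdiagonalUnit_mem_unitriangular (p : ℕ) [Fact p.Prime] (n : ℕ) {X : Type*} {l : List X}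
    (hl : l.IsChain (· ≠ ·)) (x : X) :
    superdiagonalUnit (ZMod p) n hl x ∈ unitriangular p n := by
  intro i j hij
  rw [Fin.le_def] at hij
  simp only [superdiagonalUnit, superdiagonal, add_sub_cancel_left, Matrix.of_apply]
  rw [if_neg]
  omega

/-- Words of bounded length in which consecutive letters are distinct up to inversion are not laws
of the group of unitriangular matrices. -/
theorem exists_prod_unitriangular_ne_one (p : ℕ) [Fact p.Prime] (n : ℕ) {X : Type*}
    (l : List (X × Bool)) (hl : (l.map Prod.fst).IsChain (· ≠ ·)) (hn : l.length ≤ n)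
    (hne : l ≠ []) :
    ∃ f : X → unitriangular p n,
      (l.map fun a => cond a.2 (f a.1) (f a.1)⁻¹).prod ≠ 1 := by
  classical
  let f : X → unitriangular p n := fun x => ⟨_, superdiagonalUnit_mem_unitriangular p n hl x⟩
  let D := superdiagonal (ZMod p) n (l.map Prod.fst)
  let g : X × Bool → Matrix (Fin (n + 1)) (Fin (n + 1)) (ZMod p) :=
    fun a => 1 + cond a.2 1 (-1 : ZMod p) • D a.1
  have hg : ∀ a : X × Bool, (((cond a.2 (f a.1) (f a.1)⁻¹ : unitriangular p n) :
      (Matrix (Fin (n + 1)) (Fin (n + 1)) (ZMod p))ˣ) :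
      Matrix (Fin (n + 1)) (Fin (n + 1)) (ZMod p)) = g a := by
    rintro ⟨x, _ | _⟩
    · simp only [g, cond_false, neg_smul, one_smul, ← sub_eq_add_neg]; rfl
    · simp only [g, cond_true, one_smul]; rfl
  -- The letter `x` with exponent `±1` goes to `1 ± D x`. After `k` letters, row `0` ends at column
  -- `k` with a nonzero entry: the only path from `0` to `k` takes a superdiagonal step at every
  -- letter.
  have key : ∀ k, (hk : k ≤ l.length) →
      (∀ j : Fin (n + 1), k < (j : ℕ) → ((l.take k).map g).prod 0 j = 0) ∧
      ((l.take k).map g).prod 0 ⟨k, by omega⟩ ≠ 0 := by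
    intro k
    induction k with
    | zero =>
      intro _
      refine ⟨fun j hj => ?_, ?_⟩
      · simp only [List.take_zero, List.map_nil, List.prod_nil]
        exact Matrix.one_apply_ne (fun h => by subst h; simp at hj)
      · simp
    | succ k ih =>
      intro hk
      obtain ⟨ih₁, ih₂⟩ := ih (by omega)
      have hk' : k < l.length := hk
      rw [List.take_add_one, List.getElem?_eq_getElem hk', Option.toList_some, List.map_append,
        List.prod_append, List.map_singleton, List.prod_singleton]
      have hmul : ∀ j, (((l.take k).map g).prod * g l[k]) 0 j = ((l.take k).map g).prod 0 j +
          cond l[k].2 1 (-1 : ZMod p) * ∑ i, ((l.take k).map g).prod 0 i * D l[k].1 i j := by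
        intro j
        rw [mul_add, mul_one, Matrix.add_apply, mul_smul_comm, Matrix.smul_apply, Matrix.mul_apply,
          smul_eq_mul]
      refine ⟨fun j hj => ?_, ?_⟩
      · rw [hmul, ih₁ j (by omega), Finset.sum_eq_zero, mul_zero, add_zero]
        intro i _
        by_cases hi : k < (i : ℕ)
        · rw [ih₁ i hi, zero_mul]
        · simp only [D, superdiagonal, Matrix.of_apply]
          rw [if_neg (by omega), mul_zero]
      · rw [hmul, ih₁ _ (by simp), zero_add, Finset.sum_eq_single ⟨k, by omega⟩]
        · have hx : (l.map Prod.fst)[k]? = some l[k].1 := by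
            rw [List.getElem?_map, List.getElem?_eq_getElem hk', Option.map_some]
          have : D l[k].1 ⟨k, by omega⟩ ⟨k + 1, by omega⟩ = 1 := if_pos ⟨rfl, hx⟩
          rw [this, mul_one]
          cases l[k].2 <;> simpa using ih₂
        · intro i _ hi
          simp only [D, superdiagonal, Matrix.of_apply]
          rw [if_neg, mul_zero]
          rintro ⟨h, -⟩
          exact hi (Fin.ext (by simpa using h.symm))
        · simp
  refine ⟨f, fun h => ?_⟩
  have h' := congrArg (fun u : unitriangular p n =>
    ((u : (Matrix (Fin (n + 1)) (Fin (n + 1)) (ZMod p))ˣ) :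
      Matrix (Fin (n + 1)) (Fin (n + 1)) (ZMod p))) h
  have hprod : ((l.map g).prod : Matrix (Fin (n + 1)) (Fin (n + 1)) (ZMod p)) = 1 := by
    rw [← List.map_congr_left (fun a _ => hg a)]
    let F : unitriangular p n →* Matrix (Fin (n + 1)) (Fin (n + 1)) (ZMod p) :=
      (Units.coeHom _).comp (unitriangular p n).subtype
    have : F (l.map fun a => cond a.2 (f a.1) (f a.1)⁻¹).prod = 1 := by rw [h, map_one]
    rw [map_list_prod, List.map_map] at this
    exact this
  have := (key l.length le_rfl).2
  rw [List.take_length, hprod, Matrix.one_apply_ne] at this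
  · exact this rfl
  · intro h0
    have := congrArg Fin.val h0
    simp only [Fin.val_zero] at this
    exact hne (List.length_eq_zero_iff.1 this.symm)

/-! ### Conjugates of `Q` in a semidirect product -/

section Wreath

variable (Q L A : Type*) [Group Q] [Group A]

/-- The action of `Q` on functions of `f : Q × L → A` by translation of `f`. -/
def translateAut : Q →* MulAut ((Q × L → A) → A) where
  toFun q :=
    { toFun := fun a f => a fun x => f (q * x.1, x.2)
      invFun := fun a f => a fun x => f (q⁻¹ * x.1, x.2)
      left_inv := fun a => by simp
      right_inv := fun a => by simp
      map_mul' := fun a b => rfl }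
  map_one' := by ext; simp
  map_mul' q r := by ext; simp [mul_assoc]

variable {Q L}

/-- The conjugates of `Q`, indexed by `L`, that generate a copy of a quotient of a free product. -/
def conjInr (ℓ : L) : Q →* ((Q × L → A) → A) ⋊[translateAut Q L A] Q :=
  (MulAut.conj (SemidirectProduct.inl fun f => f (1, ℓ))).toMonoidHom.comp SemidirectProduct.inr

theorem conjInr_apply (ℓ : L) (q : Q) : conjInr A ℓ q =
    SemidirectProduct.inl (fun f => f (1, ℓ)) * SemidirectProduct.inr q *
      (SemidirectProduct.inl fun f => f (1, ℓ))⁻¹ := rfl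

theorem conjInr_left_apply (ℓ : L) (q : Q) (f : Q × L → A) :
    (conjInr A ℓ q).left f = f (1, ℓ) * (f (q, ℓ))⁻¹ := by
  change f (1, ℓ) * 1 * (f (1 * q * (1⁻¹ * 1), ℓ))⁻¹ = _
  simp

theorem conjInr_right (ℓ : L) (q : Q) : (conjInr A ℓ q).right = q := by
  rw [conjInr_apply]
  simp

/-- The letters of the first component of a product of elements `conjInr A ℓ q`. -/
def conjLetters : Q → List (L × Q) → List ((Q × L) × Bool)
  | _, [] => []
  | q, (ℓ, r) :: l => ((q, ℓ), true) :: ((q * r, ℓ), false) :: conjLetters (q * r) l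

theorem length_conjLetters (q : Q) (l : List (L × Q)) :
    (conjLetters q l).length = 2 * l.length := by
  induction l generalizing q with
  | nil => rfl
  | cons a l ih => simp only [conjLetters, List.length_cons, ih]; ring

/-- Within a syllable `(ℓ, r)` the first coordinate changes from `q` to `q * r`, as `r ≠ 1`; between
syllables the label changes. -/
theorem isChain_conjLetters (q : Q) (l : List (L × Q)) (hl : l.IsChain fun a b => a.1 ≠ b.1)
    (h1 : ∀ a ∈ l, a.2 ≠ 1) : ((conjLetters q l).map Prod.fst).IsChain (· ≠ ·) := by
  induction l generalizing q with
  | nil => exact List.isChain_nil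
  | cons a l ih =>
    have ih' := ih (q * a.2) hl.tail fun b hb => h1 b (List.mem_cons_of_mem _ hb)
    simp only [conjLetters, List.map_cons]
    refine List.isChain_cons_cons.2 ⟨?_, ?_⟩
    · simpa using h1 a List.mem_cons_self
    · cases l with
      | nil => exact List.isChain_singleton _
      | cons b l =>
        refine List.isChain_cons_cons.2 ⟨?_, ih'⟩
        simpa using (List.isChain_cons_cons.1 hl).1

/-- The translate by `q` is carried along for the induction: passing a syllable `r` moves the base
point to `q * r` through the action of `Q`. -/
theorem prod_conjInr_left_apply (q : Q) (l : List (L × Q)) (f : Q × L → A) :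
    (l.map fun a => conjInr A a.1 a.2).prod.left (fun x => f (q * x.1, x.2)) =
      ((conjLetters q l).map fun a => cond a.2 (f a.1) (f a.1)⁻¹).prod := by
  induction l generalizing q with
  | nil => rfl
  | cons a l ih =>
    simp only [conjLetters, List.map_cons, List.prod_cons, cond_true, cond_false, ← ih,
      SemidirectProduct.mul_left, Pi.mul_apply, conjInr_left_apply, conjInr_right, mul_one,
      mul_assoc]
    simp [translateAut]

theorem prod_conjInr_ne_one (p : ℕ) [Fact p.Prime] (n : ℕ) (l : List (L × Q))
    (hl : l.IsChain fun a b => a.1 ≠ b.1) (h1 : ∀ a ∈ l, a.2 ≠ 1) (hne : l ≠ [])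
    (hn : l.length ≤ n) :
    (l.map fun a => conjInr (unitriangular p (2 * n)) a.1 a.2).prod ≠ 1 := by
  obtain ⟨f, hf⟩ := exists_prod_unitriangular_ne_one p (2 * n) (conjLetters 1 l)
    (isChain_conjLetters 1 l hl h1) (by rw [length_conjLetters]; omega) (by
      intro h
      have := length_conjLetters 1 l
      rw [h, List.length_nil] at this
      exact hne (List.length_eq_zero_iff.1 (by omega)))
  intro h
  apply hf
  rw [← prod_conjInr_left_apply, h]
  rfl

end Wreath

/-! ### Invariant means and powers of finite or solvable groups -/

section Amenability

open Filter Topology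

theorem IsBoundedFun.comp {X Y : Type u} {f : X → ℝ} (hf : IsBoundedFun f) (g : Y → X) :
    IsBoundedFun fun y => f (g y) :=
  let ⟨B, hB⟩ := hf
  ⟨B, fun y => hB (g y)⟩

theorem IsBoundedFun.const {X : Type u} (c : ℝ) : IsBoundedFun fun _ : X => c :=
  ⟨|c|, fun _ => le_rfl⟩

theorem IsBoundedFun.add {X : Type u} {f g : X → ℝ} (hf : IsBoundedFun f) (hg : IsBoundedFun g) :
    IsBoundedFun (f + g) :=
  let ⟨B, hB⟩ := hf
  let ⟨C, hC⟩ := hg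
  ⟨B + C, fun x => (abs_add_le _ _).trans (add_le_add (hB x) (hC x))⟩

theorem IsBoundedFun.smul {X : Type u} {f : X → ℝ} (c : ℝ) (hf : IsBoundedFun f) :
    IsBoundedFun (c • f) :=
  let ⟨B, hB⟩ := hf
  ⟨|c| * B, fun x => by
    rw [Pi.smul_apply, smul_eq_mul, abs_mul]
    exact mul_le_mul_of_nonneg_left (hB x) (abs_nonneg c)⟩

namespace IsInvariantMean

variable {G : Type u} [Group G] {m : (G → ℝ) → ℝ}

theorem map_const (hm : IsInvariantMean m) (c : ℝ) : m (fun _ => c) = c := by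
  have h := hm.map_smul c (fun _ => 1) (IsBoundedFun.const 1)
  rw [hm.map_one, mul_one] at h
  convert h using 2
  ext
  simp

theorem mono (hm : IsInvariantMean m) {f g : G → ℝ} (hf : IsBoundedFun f) (hg : IsBoundedFun g)
    (h : ∀ x, f x ≤ g x) : m f ≤ m g := by
  have h' := hm.map_add g ((-1 : ℝ) • f) hg (hf.smul _)
  rw [hm.map_smul _ f hf] at h'
  have := hm.nonneg (g + (-1 : ℝ) • f) (hg.add (hf.smul _)) fun x => by simpa using h x
  linarith

theorem abs_le (hm : IsInvariantMean m) {f : G → ℝ} {B : ℝ} (hB : ∀ x, |f x| ≤ B) :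
    |m f| ≤ B := by
  rw [_root_.abs_le]
  constructor
  · rw [← hm.map_const (-B)]
    exact hm.mono (IsBoundedFun.const _) ⟨B, hB⟩ fun x => (_root_.abs_le.1 (hB x)).1
  · rw [← hm.map_const B]
    exact hm.mono ⟨B, hB⟩ (IsBoundedFun.const _) fun x => (_root_.abs_le.1 (hB x)).2

end IsInvariantMean

/-- Extensions of amenable groups by amenable groups, and their quotients, are amenable. -/
theorem IsAmenable.of_ker_le_range {N G Q : Type u} [Group N] [Group G] [Group Q] (i : N →* G)
    (π : G →* Q) (hπ : Function.Surjective π) (hker : π.ker ≤ i.range) (hN : IsAmenable N)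
    (hQ : IsAmenable Q) : IsAmenable G := by
  obtain ⟨m, hm⟩ := hN
  obtain ⟨m', hm'⟩ := hQ
  choose s hs using hπ
  have hb : ∀ f : G → ℝ, IsBoundedFun f → IsBoundedFun fun q => m fun n => f (s q * i n) := by
    rintro f ⟨B, hB⟩
    exact ⟨B, fun q => hm.abs_le fun n => hB _⟩
  -- Average over each coset of the image of `N`, then over `Q`.
  refine ⟨fun f => m' fun q => m fun n => f (s q * i n), ?_, ?_, ?_, ?_, ?_⟩
  · intro f g hf hg
    rw [← hm'.map_add _ _ (hb f hf) (hb g hg)]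
    congr 1
    ext q
    exact hm.map_add _ _ (hf.comp _) (hg.comp _)
  · intro c f hf
    rw [← hm'.map_smul _ _ (hb f hf)]
    congr 1
    ext q
    exact hm.map_smul _ _ (hf.comp _)
  · intro f hf h
    exact hm'.nonneg _ (hb f hf) fun q => hm.nonneg _ (hf.comp _) fun n => h _
  · simp only [hm.map_one, hm'.map_one]
  · intro g f hf
    rw [← hm'.map_left_translate (π g) _ (hb f hf)]
    congr 1
    ext q
    -- Translation by `g` carries `s q` to `s (π g * q)` up to an element of the kernel, which
    -- invariance of `m` absorbs.
    obtain ⟨n₀, hn₀⟩ : (s (π g * q))⁻¹ * (g * s q) ∈ i.range :=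
      hker (by rw [MonoidHom.mem_ker]; simp [hs])
    refine Eq.trans ?_
      (hm.map_left_translate n₀ (fun n => f (s (π g * q) * i n)) (hf.comp _))
    congr 1
    ext n
    rw [map_mul, hn₀]
    group

open Classical in
/-- A locally finite group is amenable. -/
theorem IsAmenable.of_locallyFinite {G : Type u} [Group G]
    (h : ∀ S : Finset G, ∃ H : Subgroup G, Finite H ∧ (S : Set G) ⊆ H) : IsAmenable G := by
  choose H hfin hS using h
  have (S : Finset G) : Fintype (H S) := Fintype.ofFinite _
  -- The mean is the limit along `U` of averages over the finite subgroups `H S`; `g ∈ H S` holds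
  -- `U`-eventually, which gives invariance.
  let U : Ultrafilter (Finset G) := Ultrafilter.of atTop
  let a : (G → ℝ) → Finset G → ℝ := fun f S => (∑ x : H S, f x) / Fintype.card (H S)
  have hpos : ∀ S, (0 : ℝ) < Fintype.card (H S) := fun S => by exact_mod_cast Fintype.card_pos
  have hlim : ∀ f, IsBoundedFun f → ∃ r, Tendsto (a f) U (𝓝 r) := by
    rintro f ⟨B, hB⟩
    have hmem : ∀ S, a f S ∈ Set.Icc (-B) B := by
      intro S
      rw [Set.mem_Icc, ← _root_.abs_le, abs_div, Nat.abs_cast, div_le_iff₀ (hpos S)]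
      calc |∑ x : H S, f x| ≤ ∑ x : H S, |f x| := Finset.abs_sum_le_sum_abs _ _
        _ ≤ ∑ _x : H S, B := Finset.sum_le_sum fun x _ => hB x
        _ = B * Fintype.card (H S) := by simp [mul_comm]
    obtain ⟨r, -, hr⟩ := (isCompact_Icc (a := -B) (b := B)).ultrafilter_le_nhds (U.map (a f))
      (by
        rw [Filter.le_principal_iff]
        exact Filter.mem_map.2 (Filter.univ_mem' hmem))
    exact ⟨r, hr⟩
  have hm : ∀ f, IsBoundedFun f → Tendsto (a f) U (𝓝 (limUnder (U : Filter (Finset G)) (a f))) :=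
    fun f hf => tendsto_nhds_limUnder (hlim f hf)
  refine ⟨fun f => limUnder (U : Filter (Finset G)) (a f), ?_, ?_, ?_, ?_, ?_⟩
  · intro f g hf hg
    refine tendsto_nhds_unique (hm _ (hf.add hg)) (((hm f hf).add (hm g hg)).congr fun S => ?_)
    simp [a, Finset.sum_add_distrib, add_div]
  · intro c f hf
    refine tendsto_nhds_unique (hm _ (hf.smul c)) (((hm f hf).const_mul c).congr fun S => ?_)
    simp only [a, Pi.smul_apply, smul_eq_mul, ← Finset.mul_sum, mul_div_assoc]
  · intro f hf h
    have hnn : ∀ S, 0 ≤ a f S := fun S =>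
      div_nonneg (Finset.sum_nonneg fun x _ => h x.1) (hpos S).le
    exact ge_of_tendsto' (hm f hf) hnn
  · refine tendsto_nhds_unique (hm (fun _ => 1) (IsBoundedFun.const 1))
      (tendsto_const_nhds.congr fun S => ?_)
    simp [a]
  · intro g f hf
    refine tendsto_nhds_unique (hm (fun x => f (g * x)) (hf.comp (g * ·))) ((hm f hf).congr' ?_)
    have hU : ∀ᶠ S in (U : Filter (Finset G)), {g} ≤ S :=
      Ultrafilter.of_le atTop (eventually_ge_atTop _)
    filter_upwards [hU] with S hgS
    have hg : g ∈ H S := hS S (by simpa using hgS)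
    simp only [a]
    congr 1
    exact (Equiv.sum_comp (Equiv.mulLeft (⟨g, hg⟩ : H S)) fun x : H S => f x).symm

/-- Any power of a finite group is locally finite. -/
theorem exists_finite_subgroup_pi_of_finite (Ω A : Type*) [Group A] [Finite A]
    (S : Finset (Ω → A)) : ∃ H : Subgroup (Ω → A), Finite H ∧ (S : Set (Ω → A)) ⊆ H := by
  -- The range of `F` consists of the functions factoring through `ω ↦ (s ω)_{s ∈ S}`, a map into a
  -- finite set.
  let F : ((S → A) → A) →* (Ω → A) :=
    { toFun := fun g ω => g fun s => s.1 ω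
      map_one' := rfl
      map_mul' := fun _ _ => rfl }
  refine ⟨F.range, ?_, fun s hs => ⟨fun v => v ⟨s, hs⟩, rfl⟩⟩
  exact Finite.of_surjective _ F.rangeRestrict_surjective

/-- All coordinates share one derived length, so arbitrary exponents are allowed. -/
theorem Group.IsSolvable.pi_const (Ω A : Type*) [Group A] [hA : Group.IsSolvable A] :
    Group.IsSolvable (Ω → A) := by
  obtain ⟨n, hn⟩ := hA.solvable
  refine ⟨⟨n, eq_bot_iff.2 fun a ha => ?_⟩⟩
  rw [Subgroup.mem_bot]
  ext ω
  have := map_derivedSeries_le_derivedSeries (Pi.evalMonoidHom (fun _ : Ω => A) ω) n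
    (Subgroup.mem_map_of_mem _ ha)
  rw [hn, Subgroup.mem_bot] at this
  exact this

end Amenability

/-! ### Free products for extension-closed classes and for free groups -/

section FreeProducts

open Monoid.CoprodI Monoid.CoprodI.Word

/-- The closure properties of a class of groups `P` that make the class of LE-`P` groups closed
under free products. -/
structure IsFreeProductStable (p : ℕ) (P : (C : Type u) → [Group C] → Prop) : Prop where
  of_punit : P PUnit
  of_extension : ∀ {N G Q : Type u} [Group N] [Group G] [Group Q] (i : N →* G) (π : G →* Q),
    Function.Surjective π → i.range = π.ker → P N → P Q → P G
  of_pi : ∀ (Q L : Type u) (A : Type) [Group Q] [Group A], P Q → Finite L → Finite A →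
    IsPGroup p A → P ((Q × L → A) → A)

theorem Monoid.CoprodI.toList_equiv_ne_nil {ι : Type*} {G : ι → Type*} [∀ i, Group (G i)]
    [DecidableEq ι] [∀ i, DecidableEq (G i)] {x : Monoid.CoprodI G} (hx : x ≠ 1) :
    (equiv x).toList ≠ [] := by
  intro h
  apply hx
  rw [← prod_equiv x, Word.prod, h]
  rfl

theorem IsAlmostHom.map_one {G C : Type u} [Group G] [Group C] {K : Finset G} {φ : G → C}
    (hφ : IsAlmostHom K φ) (h1 : 1 ∈ K) : φ 1 = 1 := by
  have := hφ.1 1 h1 1 h1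
  rwa [mul_one, left_eq_mul] at this

theorem IsAlmostHom.map_ne_one {G C : Type u} [Group G] [Group C] {K : Finset G} {φ : G → C}
    (hφ : IsAlmostHom K φ) (h1 : 1 ∈ K) {g : G} (hg : g ∈ K) (hne : g ≠ 1) : φ g ≠ 1 := fun h =>
  hne (hφ.2 hg h1 (h.trans (hφ.map_one h1).symm))

namespace IsFreeProductStable

variable {p : ℕ} {P : (C : Type u) → [Group C] → Prop}

/-- An isomorphism is an extension with trivial kernel. -/
theorem of_mulEquiv (hP : IsFreeProductStable p P) {G H : Type u} [Group G] [Group H] (e : G ≃* H)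
    (hG : P G) : P H :=
  hP.of_extension (1 : PUnit →* H) e.symm.toMonoidHom e.symm.surjective
    (by
      rw [MonoidHom.range_one]
      exact ((MonoidHom.ker_eq_bot_iff _).2 e.symm.injective).symm)
    hP.of_punit hG

theorem pi (hP : IsFreeProductStable p P) (J : Type u) [Finite J] :
    ∀ (C : J → Type u) [∀ j, Group (C j)], (∀ j, P (C j)) → P (∀ j, C j) := by
  classical
  induction J using Finite.induction_empty_option with
  | of_equiv e ih =>
    intro C _ hC
    refine hP.of_mulEquiv ?_ (ih (fun j => C (e j)) fun j => hC (e j))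
    exact { Equiv.piCongrLeft C e with
      map_mul' := fun f g => by
        ext j
        obtain ⟨i, rfl⟩ := e.surjective j
        simp [Equiv.piCongrLeft_apply_apply] }
  | h_empty =>
    intro C _ _
    have e : PUnit.{u + 1} ≃* ∀ j : PEmpty, C j :=
      { toFun := fun _ => 1
        invFun := fun _ => PUnit.unit
        left_inv := fun _ => rfl
        right_inv := fun _ => Subsingleton.elim _ _
        map_mul' := fun _ _ => (mul_one _).symm }
    exact hP.of_mulEquiv e hP.of_punit
  | h_option ih =>
    intro C _ hC
    refine hP.of_extension (MonoidHom.mulSingle C none)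
      (MonoidHom.pi fun j => Pi.evalMonoidHom C (some j)) ?_ ?_ (hC none)
      (ih (fun j => C (some j)) fun j => hC _)
    · intro f
      refine ⟨fun o => Option.rec 1 f o, ?_⟩
      ext j
      rfl
    · ext f
      constructor
      · rintro ⟨c, rfl⟩
        ext j
        exact Pi.mulSingle_eq_of_ne (Option.some_ne_none j) c
      · intro hf
        refine ⟨f none, ?_⟩
        ext o
        cases o with
        | none => simp
        | some j =>
          have : f (some j) = 1 := congrFun (MonoidHom.mem_ker.1 hf) j
          simp [this]

theorem semidirectProduct (hP : IsFreeProductStable p P) {Q L : Type u} {A : Type} [Group Q]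
    [Group A] (hQ : P Q) (hL : Finite L) (hA : Finite A) (hpA : IsPGroup p A) :
    P (((Q × L → A) → A) ⋊[translateAut Q L A] Q) :=
  hP.of_extension SemidirectProduct.inl SemidirectProduct.rightHom
    SemidirectProduct.rightHom_surjective SemidirectProduct.range_inl_eq_ker_rightHom
    (hP.of_pi Q L A hQ hL hA hpA) hQ

theorem closedUnderFreeProducts [Fact p.Prime] (hP : IsFreeProductStable p P) :
    ClosedUnderFreeProducts (IsLocallyEmbeddable P) := by
  classical
  intro ι G _ hG
  refine isLocallyEmbeddable_of_forall_ne_one fun K => ?_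
  obtain ⟨S, J, N, h1, hK, hmul⟩ := exists_finset_mapProd_mul K
  choose C _ hC φ hφ using fun i => hG i (S i)
  let Q := ∀ j : J, C j
  -- The inclusion of a factor if `i ∈ J`, and trivial otherwise.
  let σ : ∀ i, C i →* Q := fun i =>
    MonoidHom.pi fun j => (Pi.evalMonoidHom C j).comp (MonoidHom.mulSingle C i)
  have hσ : ∀ i ∈ J, ∀ c, c ≠ 1 → σ i c ≠ 1 := by
    intro i hi c hc h
    have : Pi.mulSingle i c i = 1 := congrFun h ⟨i, hi⟩
    exact hc (by rwa [Pi.mulSingle_eq_same] at this)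
  -- Indicator functions provide finitely many labels defined on all of `ι` and separating each
  -- element of `J` from every other index.
  let label : ι → J → Prop := fun i j => (j : ι) = i
  have hlabel : ∀ i ∈ J, ∀ i', label i = label i' → i = i' := by
    intro i hi i' h
    exact (congrFun h ⟨i, hi⟩).mp rfl
  -- Each syllable contributes two letters.
  let A := unitriangular p (2 * N)
  let ψ : ∀ i, G i → ((Q × (J → Prop) → A) → A) ⋊[translateAut Q (J → Prop) A] Q :=
    fun i g => conjInr A (label i) (σ i (φ i g))
  refine ⟨_, inferInstance, hP.semidirectProduct (Q := Q) (L := J → Prop) (A := A)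
    (hP.pi J (fun j => C j) fun j => hC j) inferInstance inferInstance
    (isPGroup_unitriangular p (2 * N)), fun x => (equiv x).mapProd ψ, ?_, ?_⟩
  · refine hmul ψ (fun i => ?_) fun i g hg h hh => ?_
    · simp only [ψ, (hφ i).map_one (h1 i), map_one]
    · simp only [ψ, (hφ i).1 g hg h hh, map_mul]
  · intro k hk hne
    obtain ⟨hlen, hmem⟩ := hK k hk
    have := prod_conjInr_ne_one p N
      ((equiv k).toList.map fun l => (label l.1, σ l.1 (φ l.1 l.2))) ?_ ?_ ?_ (by simpa using hlen)
    · rwa [List.map_map] at this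
    · rw [List.isChain_map]
      refine List.isChain_iff_getElem.2 fun i hi h => ?_
      exact List.isChain_iff_getElem.1 (equiv k).chain_ne i hi
        (hlabel _ (hmem _ (List.getElem_mem _)).1 _ h)
    · simp only [List.mem_map]
      rintro _ ⟨l, hl, rfl⟩
      exact hσ _ (hmem l hl).1 _
        ((hφ l.1).map_ne_one (h1 _) (hmem l hl).2 ((equiv k).ne_one l hl))
    · simpa using toList_equiv_ne_nil hne

end IsFreeProductStable

/-- A free product of free groups is free, and a reduced word with syllables in the sets `S i` stays
reduced because `φ i` kills no nontrivial syllable. -/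
theorem closedUnderFreeProducts_isFreeGroup :
    ClosedUnderFreeProducts.{u} (IsLocallyEmbeddable.{u} fun C _ => IsFreeGroup C) := by
  classical
  intro ι G _ hG
  refine isLocallyEmbeddable_of_forall_ne_one fun K => ?_
  obtain ⟨S, J, N, h1, hK, hmul⟩ := exists_finset_mapProd_mul K
  choose C _ hC φ hφ using fun i => hG i (S i)
  let ψ : ∀ i, G i → Monoid.CoprodI C := fun i g => of (φ i g)
  refine ⟨Monoid.CoprodI C, inferInstance, inferInstance, fun x => (equiv x).mapProd ψ, ?_, ?_⟩
  · refine hmul ψ (fun i => ?_) fun i g hg h hh => ?_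
    · simp only [ψ, (hφ i).map_one (h1 i), map_one]
    · simp only [ψ, (hφ i).1 g hg h hh, map_mul]
  · intro k hk hne h
    let w : Word C :=
      { toList := (equiv k).toList.map fun l => ⟨l.1, φ l.1 l.2⟩
        ne_one := by
          simp only [List.mem_map]
          rintro _ ⟨l, hl, rfl⟩
          exact (hφ l.1).map_ne_one (h1 _) ((hK k hk).2 l hl).2 ((equiv k).ne_one l hl)
        chain_ne := by
          rw [List.isChain_map]
          exact (equiv k).chain_ne }
    have hw : w.prod = 1 := by
      rw [← h, Word.prod, List.map_map]
      rfl
    have he : w = empty := equiv.symm.injective (hw.trans prod_empty.symm)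
    exact toList_equiv_ne_nil hne (List.map_eq_nil_iff.1 (congrArg Word.toList he))

end FreeProducts

/-! ### Stability of the individual classes -/

theorem IsPGroup.of_ker {p : ℕ} {G Q : Type*} [Group G] [Group Q] (π : G →* Q)
    (hker : IsPGroup p π.ker) (hQ : IsPGroup p Q) : IsPGroup p G := by
  rw [isPGroup_iff_pow_pow_eq_one] at *
  intro g
  obtain ⟨a, ha⟩ := hQ (π g)
  obtain ⟨b, hb⟩ := hker ⟨g ^ p ^ a, by rw [MonoidHom.mem_ker, map_pow, ha]⟩
  refine ⟨a + b, ?_⟩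
  rw [pow_add, pow_mul]
  exact congrArg Subtype.val hb

theorem Finite.of_range_eq_ker {N G Q : Type*} [Group N] [Group G] [Group Q] (i : N →* G)
    (π : G →* Q) (h : i.range = π.ker) [Finite N] [Finite Q] : Finite G := by
  have : Finite i.range := Finite.of_surjective _ i.rangeRestrict_surjective
  rw [h] at this
  have : Finite (G ⧸ π.ker) := Finite.of_injective _ (QuotientGroup.kerLift_injective π)
  exact Finite.of_equiv _ (Subgroup.groupEquivQuotientProdSubgroup (s := π.ker)).symm

theorem isFreeProductStable_finite (p : ℕ) :
    IsFreeProductStable.{u} p fun C _ => Finite C where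
  of_punit := inferInstance
  of_extension i π _ h _ _ := Finite.of_range_eq_ker i π h
  of_pi _ _ _ _ _ _ _ _ _ := inferInstance

theorem isFreeProductStable_finite_isPGroup (p : ℕ) [Fact p.Prime] :
    IsFreeProductStable.{u} p fun C _ => Finite C ∧ IsPGroup p C where
  of_punit := ⟨inferInstance, .of_subsingleton p _⟩
  of_extension i π _ h hN hQ := by
    have := hN.1
    have := hQ.1
    refine ⟨Finite.of_range_eq_ker i π h, IsPGroup.of_ker π ?_ hQ.2⟩
    rw [← h]
    exact hN.2.of_surjective _ i.rangeRestrict_surjective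
  of_pi Q L A _ _ hQ _ _ hA := by
    have := hQ.1
    refine ⟨inferInstance, (isPGroup_iff_pow_pow_eq_one).2 fun g => ?_⟩
    -- The order of `A` is an exponent for every power of `A`.
    obtain ⟨n, hn⟩ := IsPGroup.iff_card.1 hA
    refine ⟨n, ?_⟩
    ext f
    rw [Pi.pow_apply, ← hn, pow_card_eq_one']
    rfl

theorem IsPGroup.isSolvable_pi_const {p : ℕ} [Fact p.Prime] (Ω A : Type*) [Group A] [Finite A]
    (hA : IsPGroup p A) : Group.IsSolvable (Ω → A) := by
  have := hA.isNilpotent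
  exact Group.IsSolvable.pi_const Ω A

theorem isFreeProductStable_isSolvable (p : ℕ) [Fact p.Prime] :
    IsFreeProductStable.{u} p fun C _ => Group.IsSolvable C where
  of_punit := inferInstance
  of_extension i π _ h _ _ := Group.isSolvable_of_ker_le_range i π h.ge
  of_pi _ _ _ _ _ _ _ _ hA := hA.isSolvable_pi_const _ _

theorem isFreeProductStable_isElementaryAmenable (p : ℕ) [Fact p.Prime] :
    IsFreeProductStable.{u} p fun C _ => IsElementaryAmenable C where
  of_punit := .of_finite _ inferInstance
  of_extension i π hπ h hN hQ := by
    have hr := hN.of_surjective i.rangeRestrict i.rangeRestrict_surjective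
    rw [h] at hr
    refine .of_extension π.ker hr ?_
    exact hQ.of_surjective (QuotientGroup.quotientKerEquivOfSurjective π hπ).symm.toMonoidHom
      (MulEquiv.surjective _)
  of_pi _ _ _ _ _ _ _ _ hA := .of_solvable _ (hA.isSolvable_pi_const _ _)

theorem isFreeProductStable_isAmenable (p : ℕ) :
    IsFreeProductStable.{u} p fun C _ => IsAmenable C where
  of_punit := .of_locallyFinite fun _ => ⟨⊤, inferInstance, fun _ _ => trivial⟩
  of_extension i π hπ h := .of_ker_le_range i π hπ h.ge
  of_pi _ _ A _ _ _ _ _ _ := .of_locallyFinite (exists_finite_subgroup_pi_of_finite _ A)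

theorem corollary6 :
    ClosedUnderFreeProducts.{u} (IsLocallyEmbeddable.{u} fun C _ => Finite C) ∧
    (∀ p : ℕ, p.Prime →
      ClosedUnderFreeProducts.{u} (IsLocallyEmbeddable.{u} fun C _ => Finite C ∧ IsPGroup p C)) ∧
    ClosedUnderFreeProducts.{u} (IsLocallyEmbeddable.{u} fun C _ => Group.IsSolvable C) ∧
    ClosedUnderFreeProducts.{u} (IsLocallyEmbeddable.{u} fun C _ => IsFreeGroup C) ∧
    ClosedUnderFreeProducts.{u} (IsLocallyEmbeddable.{u} fun C _ => IsElementaryAmenable C) ∧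
    ClosedUnderFreeProducts.{u} (IsLocallyEmbeddable.{u} fun C _ => IsAmenable C) := by
  -- Outside the `p`-group case the prime is auxiliary; `2` is an arbitrary choice.
  refine ⟨(isFreeProductStable_finite 2).closedUnderFreeProducts, fun p hp => ?_,
    (isFreeProductStable_isSolvable 2).closedUnderFreeProducts, closedUnderFreeProducts_isFreeGroup,
    (isFreeProductStable_isElementaryAmenable 2).closedUnderFreeProducts,
    (isFreeProductStable_isAmenable 2).closedUnderFreeProducts⟩
  have := Fact.mk hp
  exact (isFreeProductStable_finite_isPGroup p).closedUnderFreeProducts
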